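/- Let $\mathcal M=(S,A,P,d_0,L)$ be a labelled Markov decision process with finite state space $S$, finite nonempty action space $A$, transition probabilities $P(\cdot\mid s,a)$, initial distribution $d_0$ and labelling $L:S\to 2^{\mathrm{AP}}$. Let $\mathcal B$ be a limit-deterministic Büchi automaton (for a specification $\varphi$) over the alphabet $2^{\mathrm{AP}}$ with finite state set $Q$, initial state $q_{\mathrm{init}}$, deterministic letter transitions $\delta:Q\times 2^{\mathrm{AP}}\to Q$, finitely many jump ($\varepsilon$-)transitions $J(b)$ at each $b\in Q$, and accepting set $Q^*\subseteq Q$; jumps lead from an initial component into a component that is closed under $\delta$, has no jumps and contains $Q^*$. Consider the product MDP with states $z=(s,b)\in \mathcal Z=S\times Q$, and with the available actions $A\sqcup J(b)$ at $(s,b)$: an action $a\in A$ leads to $(s',\delta(b,L(s')))$ with $s'\sim P(\cdot\mid s,a)$; a jump $e\in J(b)$ leads to $(s,b')$, where $b'$ is the target of $e$. The initial state is $(s_0,\delta(q_{\mathrm{init}},L(s_0)))$ with $s_0\sim d_0$. Let $\Pi$ be the set of stationary (possibly stochastic) policies of the product MDP, and $\Pi_{\det}\subseteq\Pi$ the set of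 deterministic ones. For a trajectory $\tau$ with states $(s_0,b_0),(s_1,b_1),\dots$ let $O(\tau)=\{i : b_i\in Q^*\}$, and write $\tau\models\varphi$ if $b_0,b_1,\dots$ is accepted by $\mathcal B$, i.e. if $|O(\tau)|=\infty$. For $\pi\in\Pi$ and $\gamma\in(0,1)$ let $\mathbb P[\pi\models\varphi]$ be the probability that a trajectory generated by $\pi$ satisfies $\varphi$; let $$V_\pi^\gamma=\mathbb E_{\tau\sim\pi}\Big[\sum_{i\ge 0}\Gamma_i\,\mathbf 1_{\{b_i\in Q^*\}}\Big],\qquad \Gamma_i=\prod_{t<i}\gamma_t,\qquad \gamma_t=\begin{cases}\gamma & b_t\in Q^*,\\ 1& b_t\notin Q^*;\end{cases}$$ and let $O_\pi=\mathbb E_{\tau\sim\pi}\big[|O(\tau)|\,\big|\,\tau\not\models\varphi\big]$, with $O_\pi=0$ if $\mathbb P[\pi\not\models\varphi]=0$. Then: 1. $\mathcal Z$ and $\mathcal A=A\sqcup\bigsqcup_{b}J(b)$ are finite, and $\Pi_{\det}$ is finite. 2. Optimal policies can be chosen deterministic: some $\pi^*\in\Pi_{\det}$ satisfies $\mathbb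 P[\pi^*\models\varphi]=\sup_{\pi\in\Pi}\mathbb P[\pi\models\varphi]$, and for every $\gamma\in(0,1)$ some policy in $\Pi_{\det}$ attains $\sup_{\pi\in\Pi}V_\pi^\gamma$. 3. $m:=\sup_{\pi\in\Pi_{\det}}O_\pi$ is finite and attained, and for every $\gamma\in(0,1)$ and every $\pi_\gamma^*\in\arg\max_{\pi\in\Pi_{\det}}V_\pi^\gamma$, $$\sup_{\pi\in\Pi}\mathbb P[\pi\models\varphi]-\mathbb P[\pi_\gamma^*\models\varphi]\le 2m\log\big(\tfrac1\gamma\big).$$ -/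

import Mathlib

open MeasureTheory ProbabilityTheory Filter
open scoped NNReal ENNReal

noncomputable section

/-! ### Markov decision processes, policies and trajectories -/

/-- A Markov decision process with state space `Z` in which the actions available in state `z`
form the type `Act z`: an initial distribution and a transition function. -/
structure MDP (Z : Type*) (Act : Z → Type*) where
  init : PMF Z
  trans : (z : Z) → Act z → PMF Z

/-- A stationary (Markov, stochastic) policy: a probability distribution on the available
actions for every state. -/
def Policy {Z : Type*} (Act : Z → Type*) : Type _ := (z : Z) → PMF (Act z)

/-- A deterministic policy: an available action for every state. -/
def DetPolicy {Z : Type*} (Act : Z → Type*) : Type _ := (z : Z) → Act z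

/-- A deterministic policy, regarded as the stochastic policy that puts all mass on its action. -/
def DetPolicy.toPolicy {Z : Type*} {Act : Z → Type*} (d : DetPolicy Act) : Policy Act :=
  fun z => PMF.pure (d z)

namespace MDP

variable {Z : Type*} {Act : Z → Type*}

/-- The one-step law of the state under `π`: draw `a ∼ π z`, then `z' ∼ P(· | z, a)`. -/
def step (M : MDP Z Act) (π : Policy Act) (z : Z) : PMF Z := (π z).bind (M.trans z)

variable [MeasurableSpace Z] [DiscreteMeasurableSpace Z]

/-- The transition kernel at time `n`, as a function of the history `z₀, …, zₙ`; it depends on the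
current state `zₙ` only. -/
def stepKernel (M : MDP Z Act) (π : Policy Act) (n : ℕ) :
    Kernel ((i : Finset.Iic n) → (fun _ : ℕ => Z) i) Z where
  toFun h := (M.step π (h ⟨n, Finset.mem_Iic.2 le_rfl⟩)).toMeasure
  measurable' :=
    (Measurable.of_discrete (f := fun z : Z => (M.step π z).toMeasure)).comp
      (measurable_pi_apply (⟨n, Finset.mem_Iic.2 le_rfl⟩ : Finset.Iic n))

instance (M : MDP Z Act) (π : Policy Act) (n : ℕ) : IsMarkovKernel (M.stepKernel π n) :=
  ⟨fun _ => PMF.toMeasure.isProbabilityMeasure _⟩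

/-- The law of the state sequence `z₀, z₁, z₂, …` of a random trajectory generated by following
`π`, with `z₀` drawn from the initial distribution. (The actions are integrated out: satisfaction,
visits and values are functions of the state sequence.) -/
def trajLaw (M : MDP Z Act) (π : Policy Act) : Measure (ℕ → Z) :=
  Kernel.trajMeasure (X := fun _ => Z) M.init.toMeasure (M.stepKernel π)

instance (M : MDP Z Act) (π : Policy Act) : IsProbabilityMeasure (M.trajLaw π) := by
  unfold trajLaw
  infer_instance

end MDP

/-! ### Visits to a set of good states, values and satisfaction probabilities -/

section Visits

variable {Z : Type*}

/-- `O(τ)`, the set of times at which the trajectory `τ` is in a good state. -/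
def visits (G : Set Z) (τ : ℕ → Z) : Set ℕ := {i | τ i ∈ G}

/-- `|O(τ)|`, the number of visits to good states, possibly infinite. -/
def numVisits (G : Set Z) (τ : ℕ → Z) : ℝ≥0∞ := ((visits G τ).encard : ℝ≥0∞)

/-- The trajectories that satisfy the Büchi condition: good states are visited infinitely often. -/
def satSet (G : Set Z) : Set (ℕ → Z) := {τ | ∃ᶠ i in atTop, τ i ∈ G}

open Classical in
/-- The eventual discount `Γ_i = ∏_{t < i} γ_t`, where `γ_t = γ` if the state at time `t` is good
and `γ_t = 1` otherwise. -/
def eventualDiscount (G : Set Z) (γ : ℝ) (τ : ℕ → Z) (i : ℕ) : ℝ :=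
  ∏ t ∈ Finset.range i, if τ t ∈ G then γ else 1

end Visits

namespace MDP

variable {Z : Type*} {Act : Z → Type*} [MeasurableSpace Z] [DiscreteMeasurableSpace Z]

/-- The probability that a trajectory generated by `π` satisfies the Büchi condition. -/
def satProb (M : MDP Z Act) (G : Set Z) (π : Policy Act) : ℝ := (M.trajLaw π).real (satSet G)

open Classical in
/-- The eventually discounted value `V_π^γ = 𝔼 [∑_i Γ_i 1{z_i good}]`. -/
def value (M : MDP Z Act) (G : Set Z) (γ : ℝ) (π : Policy Act) : ℝ≥0∞ :=
  ∫⁻ τ, ∑' i : ℕ, ENNReal.ofReal (eventualDiscount G γ τ i * if τ i ∈ G then 1 else 0)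
    ∂(M.trajLaw π)

/-- `O_π`, the expected number of visits to good states conditionally on the trajectory not
satisfying the Büchi condition (and `0` if almost every trajectory satisfies it). -/
def expVisits (M : MDP Z Act) (G : Set Z) (π : Policy Act) : ℝ≥0∞ :=
  ∫⁻ τ, numVisits G τ ∂((M.trajLaw π)[|(satSet G)ᶜ])

end MDP

/-! ### Labelled MDPs, limit-deterministic Büchi automata and their product -/

/-- An MDP with states `S` and actions `A`, whose states are labelled by sets of atomic
propositions. -/
structure LabelledMDP (S A AP : Type*) where
  init : PMF S
  trans : S → A → PMF S
  label : S → Set AP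

/-- A limit-deterministic Büchi automaton over the alphabet of sets of atomic propositions, with
states `Q` and jump (`ε`-)transitions `J b` at the state `b`. Apart from the jumps, which lead from
the initial component into the component `det`, its transitions are deterministic; the component
`det` is closed under reading letters, has no jumps, and contains all accepting states. -/
structure LDBA (AP Q : Type*) (J : Q → Type*) where
  start : Q
  next : Q → Set AP → Q
  jump : (b : Q) → J b → Q
  accepting : Set Q
  det : Set Q
  accepting_subset : accepting ⊆ det
  next_mem : ∀ b ∈ det, ∀ σ, next b σ ∈ det
  jump_mem : ∀ b e, jump b e ∈ det
  no_jump : ∀ b ∈ det, IsEmpty (J b)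

/-- The actions of the product at the state `z = (s, b)`: the actions of the MDP and the jumps of
the automaton that are available at `b`. -/
abbrev ProductAct (S A : Type*) {Q : Type*} (J : Q → Type*) (z : S × Q) : Type _ := A ⊕ J z.2

/-- The product MDP. An action of the MDP moves `s` to a random `s'` while the automaton reads the
label of `s'`; a jump changes the state of the automaton only. Initially the automaton reads the
label of the initial state of the MDP. -/
def productMDP {S A AP Q : Type*} {J : Q → Type*} (M : LabelledMDP S A AP) (B : LDBA AP Q J) :
    MDP (S × Q) (ProductAct S A J) where
  init := M.init.map fun s => (s, B.next B.start (M.label s))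
  trans z
    | .inl a => (M.trans z.1 a).map fun s' => (s', B.next z.2 (M.label s'))
    | .inr e => PMF.pure (z.1, B.jump z.2 e)

/-- The product states whose automaton component is accepting. -/
def goodStates {AP Q : Type*} {J : Q → Type*} (S : Type*) (B : LDBA AP Q J) : Set (S × Q) :=
  {z | z.2 ∈ B.accepting}

end

/-! For a fixed discount the value is an expected total reward with state-dependent weights, so it
is maximized by a deterministic policy that is greedy for the least fixed point of the Bellman
operator.

On a trajectory `τ` the rewards telescope: `(1 - γ) ∑ i < n, Γ_i 1{τ i ∈ G} = 1 - Γ_n`. Hence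
`(1 - γ)` times the discounted number of visits is `1` if there are infinitely many visits, and at
most `1` and at most `(1 - γ) |O(τ)|` otherwise. With `E_π` the expectation of `|O(τ)|` over the
trajectories with finitely many visits, this gives
`ℙ[π ⊨ φ] ≤ (1 - γ) V_π^γ ≤ ℙ[π ⊨ φ] + (1 - γ) E_π`. Comparing a maximizer of the value with an
arbitrary policy bounds the gap by `(1 - γ) E_π ≤ (1 - γ) O_π`, and `γ → 1` along values of `γ` with
a common deterministic maximizer shows that this maximizer is also optimal for `ℙ[π ⊨ φ]`. -/

section Reward

variable {α β Z : Type*}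

/-- The expectation of an extended nonnegative function, as a linear functional of it. -/
noncomputable def pmfMean (p : PMF α) : (α → ℝ≥0∞) →ₗ[ℝ≥0∞] ℝ≥0∞ where
  toFun f := ∑' a, p a * f a
  map_add' f f' := by simp only [Pi.add_apply, mul_add, ENNReal.tsum_add]
  map_smul' c f := by
    simp only [Pi.smul_apply, smul_eq_mul, mul_left_comm _ c, ENNReal.tsum_mul_left,
      RingHom.id_apply]

theorem pmfMean_apply (p : PMF α) (f : α → ℝ≥0∞) : pmfMean p f = ∑' a, p a * f a := rfl

theorem pmfMean_mono (p : PMF α) : Monotone (pmfMean p) := fun _ _ h =>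
  ENNReal.tsum_le_tsum fun a => mul_le_mul_right (h a) (p a)

theorem pmfMean_const (p : PMF α) (c : ℝ≥0∞) : pmfMean p (fun _ => c) = c := by
  rw [pmfMean_apply, ENNReal.tsum_mul_right, PMF.tsum_coe, one_mul]

theorem pmfMean_le_of_forall_le (p : PMF α) {f : α → ℝ≥0∞} {c : ℝ≥0∞} (h : ∀ a, f a ≤ c) :
    pmfMean p f ≤ c :=
  (pmfMean_mono p h).trans_eq (pmfMean_const p c)

theorem pmfMean_bind (p : PMF α) (q : α → PMF β) (f : β → ℝ≥0∞) :
    pmfMean (p.bind q) f = pmfMean p fun a => pmfMean (q a) f := by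
  simp only [pmfMean_apply, PMF.bind_apply, ← ENNReal.tsum_mul_right, ← ENNReal.tsum_mul_left,
    mul_assoc]
  exact ENNReal.tsum_comm

theorem lintegral_toMeasure [Countable α] [MeasurableSpace α] [MeasurableSingletonClass α]
    (p : PMF α) (f : α → ℝ≥0∞) : ∫⁻ a, f a ∂p.toMeasure = pmfMean p f := by
  simp only [lintegral_countable', pmfMean_apply,
    p.toMeasure_apply_singleton _ (measurableSet_singleton _), mul_comm]

/-- The weighted transition operator `f ↦ g · P f` of the Markov chain with transition function
`p`, where `(P f) z` is the mean of `f` after one step from `z`. -/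
noncomputable def transOp (p : Z → PMF Z) (g : Z → ℝ≥0∞) : Module.End ℝ≥0∞ (Z → ℝ≥0∞) :=
  LinearMap.pi fun z => g z • pmfMean (p z)

theorem transOp_apply (p : Z → PMF Z) (g f : Z → ℝ≥0∞) (z : Z) :
    transOp p g f z = g z * pmfMean (p z) f := rfl

theorem transOp_smul (p : Z → PMF Z) (c : ℝ≥0∞) (g : Z → ℝ≥0∞) :
    transOp p (c • g) = c • transOp p g := by
  ext f z
  simp only [transOp_apply, LinearMap.smul_apply, Pi.smul_apply, smul_eq_mul, mul_assoc]

theorem transOp_mono (p : Z → PMF Z) (g : Z → ℝ≥0∞) : Monotone (transOp p g) := fun _ _ h z =>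
  mul_le_mul_right (pmfMean_mono (p z) h) (g z)

theorem transOp_pow_mono (p : Z → PMF Z) (g : Z → ℝ≥0∞) (n : ℕ) :
    Monotone (transOp p g ^ n) := by
  rw [Module.End.coe_pow]
  exact (transOp_mono p g).iterate n

theorem transOp_pow_apply_le (p : Z → PMF Z) {g f : Z → ℝ≥0∞} {c C : ℝ≥0∞} (hg : ∀ z, g z ≤ c)
    (hf : ∀ z, f z ≤ C) (n : ℕ) (z : Z) : (transOp p g ^ n) f z ≤ c ^ n * C := by
  induction n generalizing z with
  | zero => simpa using hf z
  | succ n ih =>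
    rw [pow_succ', Module.End.mul_apply, transOp_apply, pow_succ', mul_assoc]
    exact mul_le_mul' (hg z) (pmfMean_le_of_forall_le (p z) ih)

/-- The expected total reward `𝔼_z [∑ i, (∏ t < i, g (z t)) * r (z i)]` of the Markov chain with
transition function `p` started at `z`, where the weights `g` act as state-dependent discounts. -/
noncomputable def totalReward (p : Z → PMF Z) (g r : Z → ℝ≥0∞) (z : Z) : ℝ≥0∞ :=
  ∑' i, (transOp p g ^ i) r z

theorem totalReward_smul (p : Z → PMF Z) (c : ℝ≥0∞) (g r : Z → ℝ≥0∞) (z : Z) :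
    totalReward p (c • g) r z = ∑' i, c ^ i * (transOp p g ^ i) r z := by
  simp only [totalReward, transOp_smul, smul_pow, LinearMap.smul_apply, Pi.smul_apply, smul_eq_mul]

theorem totalReward_le_of_supersolution {p : Z → PMF Z} {g r v : Z → ℝ≥0∞}
    (hv : r + transOp p g v ≤ v) : totalReward p g r ≤ v := by
  have hpartial (n : ℕ) : ∑ i ∈ Finset.range n, (transOp p g ^ i) r ≤ v := by
    induction n with
    | zero => simp
    | succ n ih =>
      calc ∑ i ∈ Finset.range (n + 1), (transOp p g ^ i) r
          = r + transOp p g (∑ i ∈ Finset.range n, (transOp p g ^ i) r) := by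
            simp only [Finset.sum_range_succ', map_sum, pow_succ', Module.End.mul_apply, pow_zero,
              Module.End.one_apply, add_comm]
        _ ≤ r + transOp p g v := by gcongr; exact transOp_mono p g ih
        _ ≤ v := hv
  refine fun z => ENNReal.tsum_le_of_sum_range_le fun n => ?_
  simpa only [Finset.sum_apply] using hpartial n z

theorem le_totalReward_of_subsolution {p : Z → PMF Z} {g r v : Z → ℝ≥0∞} {c C : ℝ≥0∞}
    (hv : v ≤ r + transOp p g v) (hg : ∀ z, g z ≤ c) (hc : c < 1) (hvC : ∀ z, v z ≤ C)
    (hC : C ≠ ∞) : v ≤ totalReward p g r := by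
  have hpartial (n : ℕ) : v ≤ ∑ i ∈ Finset.range n, (transOp p g ^ i) r + (transOp p g ^ n) v := by
    induction n with
    | zero => simp
    | succ n ih =>
      calc v ≤ ∑ i ∈ Finset.range n, (transOp p g ^ i) r + (transOp p g ^ n) v := ih
        _ ≤ ∑ i ∈ Finset.range n, (transOp p g ^ i) r +
              (transOp p g ^ n) (r + transOp p g v) := by
            gcongr
            exact transOp_pow_mono p g n hv
        _ = _ := by
            rw [map_add, Finset.sum_range_succ, pow_succ, Module.End.mul_apply, add_assoc]
  intro z
  have hlim : Tendsto (fun n => totalReward p g r z + c ^ n * C) atTop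
      (nhds (totalReward p g r z + 0 * C)) :=
    tendsto_const_nhds.add (ENNReal.Tendsto.mul_const
      (ENNReal.tendsto_pow_atTop_nhds_zero_of_lt_one hc) (Or.inr hC))
  rw [zero_mul, add_zero] at hlim
  refine ge_of_tendsto' hlim fun n => (hpartial n z).trans ?_
  rw [Pi.add_apply, Finset.sum_apply]
  exact add_le_add (ENNReal.sum_le_tsum _) (transOp_pow_apply_le p hg hvC n z)

end Reward

namespace MDP

variable {Z : Type*} {Act : Z → Type*}

theorem step_toPolicy (M : MDP Z Act) (d : DetPolicy Act) (z : Z) :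
    M.step d.toPolicy z = M.trans z (d z) :=
  PMF.pure_bind _ _

/-- The Bellman optimality operator for rewards `r` and weights `g`. -/
noncomputable def bellman (M : MDP Z Act) (g r : Z → ℝ≥0∞) :
    (Z → ℝ≥0∞) →o (Z → ℝ≥0∞) where
  toFun v z := r z + g z * ⨆ a, pmfMean (M.trans z a) v
  monotone' v v' h z := by
    dsimp only
    gcongr
    exact pmfMean_mono _ h

theorem bellman_apply (M : MDP Z Act) (g r v : Z → ℝ≥0∞) (z : Z) :
    M.bellman g r v z = r z + g z * ⨆ a, pmfMean (M.trans z a) v := rfl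

theorem add_transOp_step_le_bellman (M : MDP Z Act) (π : Policy Act) (g r v : Z → ℝ≥0∞) :
    r + transOp (M.step π) g v ≤ M.bellman g r v := fun z => by
  rw [Pi.add_apply, transOp_apply, bellman_apply, step, pmfMean_bind]
  gcongr
  exact pmfMean_le_of_forall_le _ fun a => le_iSup (fun a => pmfMean (M.trans z a) v) a

theorem exists_detPolicy_bellman_eq [∀ z, Finite (Act z)] [∀ z, Nonempty (Act z)]
    (M : MDP Z Act) (g r v : Z → ℝ≥0∞) :
    ∃ d : DetPolicy Act, M.bellman g r v = r + transOp (M.step d.toPolicy) g v := by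
  obtain ⟨d, hd⟩ : ∃ d : DetPolicy Act, ∀ z,
      pmfMean (M.trans z (d z)) v = ⨆ a, pmfMean (M.trans z a) v :=
    Classical.axiom_of_choice fun z =>
      exists_eq_ciSup_of_finite (f := fun a : Act z => pmfMean (M.trans z a) v)
  refine ⟨d, funext fun z => ?_⟩
  rw [Pi.add_apply, transOp_apply, bellman_apply, step_toPolicy, hd]

theorem lfp_bellman_le (M : MDP Z Act) {g r : Z → ℝ≥0∞} {c R : ℝ≥0∞} (hg : ∀ z, g z ≤ c)
    (hc : c < 1) (hr : ∀ z, r z ≤ R) (z : Z) : (M.bellman g r).lfp z ≤ R / (1 - c) := by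
  refine OrderHom.lfp_le (M.bellman g r) (a := fun _ => R / (1 - c)) (fun z => ?_) z
  calc M.bellman g r (fun _ => R / (1 - c)) z
      ≤ R + c * (R / (1 - c)) :=
        add_le_add (hr z) (mul_le_mul' (hg z) (iSup_le fun _ => (pmfMean_const _ _).le))
    _ = (1 - c) * (R / (1 - c)) + c * (R / (1 - c)) := by
        rw [ENNReal.mul_div_cancel (tsub_pos_of_lt hc).ne' (by finiteness)]
    _ = R / (1 - c) := by rw [← add_mul, tsub_add_cancel_of_le hc.le, one_mul]

theorem exists_detPolicy_totalReward_of_lt_one [∀ z, Finite (Act z)] [∀ z, Nonempty (Act z)]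
    (M : MDP Z Act) {g r : Z → ℝ≥0∞} {c R : ℝ≥0∞} (hg : ∀ z, g z ≤ c) (hc : c < 1)
    (hr : ∀ z, r z ≤ R) (hR : R ≠ ∞) :
    ∃ d : DetPolicy Act, ∀ π : Policy Act,
      totalReward (M.step π) g r ≤ totalReward (M.step d.toPolicy) g r := by
  set v := (M.bellman g r).lfp
  have hfix : M.bellman g r v = v := (M.bellman g r).map_lfp
  obtain ⟨d, hd⟩ := M.exists_detPolicy_bellman_eq g r v
  refine ⟨d, fun π => ?_⟩
  calc totalReward (M.step π) g r
      ≤ v := totalReward_le_of_supersolution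
        ((M.add_transOp_step_le_bellman π g r v).trans_eq hfix)
    _ ≤ totalReward (M.step d.toPolicy) g r :=
      le_totalReward_of_subsolution (hfix.symm.trans hd).le hg hc (M.lfp_bellman_le hg hc hr)
        (ENNReal.div_ne_top hR (tsub_pos_of_lt hc).ne')

instance [Finite Z] [∀ z, Finite (Act z)] : Finite (DetPolicy Act) :=
  inferInstanceAs (Finite ((z : Z) → Act z))

/-- Approximating the weights `g` by `c • g` with `c < 1`, one of the finitely many deterministic
policies is optimal for `c` arbitrarily close to `1`, hence also in the limit. -/
theorem exists_detPolicy_totalReward [Finite Z] [∀ z, Finite (Act z)] [∀ z, Nonempty (Act z)]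
    (M : MDP Z Act) {g r : Z → ℝ≥0∞} {R : ℝ≥0∞} (hg : ∀ z, g z ≤ 1) (hr : ∀ z, r z ≤ R)
    (hR : R ≠ ∞) :
    ∃ d : DetPolicy Act, ∀ π : Policy Act,
      totalReward (M.step π) g r ≤ totalReward (M.step d.toPolicy) g r := by
  have : (nhdsWithin (1 : ℝ≥0∞) (Set.Iio 1)).NeBot := nhdsLT_neBot_of_exists_lt ⟨0, one_pos⟩
  have hdiscounted (c : ℝ≥0∞) (hc : c < 1) : ∃ d : DetPolicy Act, ∀ π : Policy Act,
      totalReward (M.step π) (c • g) r ≤ totalReward (M.step d.toPolicy) (c • g) r :=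
    M.exists_detPolicy_totalReward_of_lt_one (fun z => mul_le_of_le_one_right' (hg z)) hc hr hR
  obtain ⟨d, hd⟩ := frequently_exists.1
    (eventually_nhdsWithin_of_forall (a := (1 : ℝ≥0∞)) (s := Set.Iio 1) hdiscounted).frequently
  refine ⟨d, fun π z => ENNReal.tsum_le_of_sum_range_le fun n => ?_⟩
  have hlim : Tendsto (fun c : ℝ≥0∞ => ∑ i ∈ Finset.range n, c ^ i * (transOp (M.step π) g ^ i) r z)
      (nhdsWithin 1 (Set.Iio 1))
      (nhds (∑ i ∈ Finset.range n, 1 ^ i * (transOp (M.step π) g ^ i) r z)) :=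
    tendsto_finsetSum _ fun i _ => ENNReal.Tendsto.mul_const
      (((ENNReal.continuous_pow i).tendsto 1).mono_left nhdsWithin_le_nhds) (Or.inl (by simp))
  simp only [one_pow, one_mul] at hlim
  refine le_of_tendsto_of_frequently hlim ((hd.and_eventually self_mem_nhdsWithin).mono ?_)
  rintro c ⟨hd, hc : c < 1⟩
  calc ∑ i ∈ Finset.range n, c ^ i * (transOp (M.step π) g ^ i) r z
      ≤ ∑' i, c ^ i * (transOp (M.step π) g ^ i) r z := ENNReal.sum_le_tsum _
    _ = totalReward (M.step π) (c • g) r z := (totalReward_smul _ c g r z).symm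
    _ ≤ totalReward (M.step d.toPolicy) (c • g) r z := hd π z
    _ ≤ totalReward (M.step d.toPolicy) g r z := by
        rw [totalReward_smul]
        exact ENNReal.tsum_le_tsum fun i => mul_le_of_le_one_left' (pow_le_one' hc.le i)

end MDP

theorem measurable_comp_apply {Z β : Type*} [MeasurableSpace Z] [DiscreteMeasurableSpace Z]
    [MeasurableSpace β] (f : Z → β) (i : ℕ) :
    Measurable fun τ : ℕ → Z => f (τ i) :=
  (Measurable.of_discrete (f := f)).comp (measurable_pi_apply i)

theorem measurable_prod_comp_apply {Z ι : Type*} [MeasurableSpace Z] [DiscreteMeasurableSpace Z]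
    (g : Z → ℝ≥0∞) (s : Finset ι) (u : ι → ℕ) :
    Measurable fun τ : ℕ → Z => ∏ t ∈ s, g (τ (u t)) :=
  Finset.measurable_fun_prod _ fun t _ => measurable_comp_apply g (u t)

namespace MDP

variable {Z : Type*} {Act : Z → Type*} [MeasurableSpace Z] [DiscreteMeasurableSpace Z]

theorem lintegral_trajLaw_zero [Countable Z] (M : MDP Z Act) (π : Policy Act) (f : Z → ℝ≥0∞) :
    ∫⁻ τ, f (τ 0) ∂(M.trajLaw π) = pmfMean M.init f := by
  have hmap : (M.trajLaw π).map (Preorder.frestrictLe (π := fun _ => Z) 0) =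
      M.init.toMeasure.map (MeasurableEquiv.piUnique fun _ : Finset.Iic 0 => Z).symm := by
    rw [trajLaw, Kernel.trajMeasure, Measure.map_comp _ _ (Preorder.measurable_frestrictLe 0),
      Kernel.traj_map_frestrictLe, Kernel.partialTraj_self, Measure.id_comp]
  have hf : Measurable fun y : Finset.Iic 0 → Z => f (y ⟨0, Finset.mem_Iic.2 le_rfl⟩) :=
    (Measurable.of_discrete (f := f)).comp (measurable_pi_apply _)
  calc ∫⁻ τ, f (τ 0) ∂(M.trajLaw π)
      = ∫⁻ y, f (y ⟨0, Finset.mem_Iic.2 le_rfl⟩)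
          ∂((M.trajLaw π).map (Preorder.frestrictLe (π := fun _ => Z) 0)) := by
        rw [lintegral_map hf (Preorder.measurable_frestrictLe 0)]
        rfl
    _ = ∫⁻ z, f z ∂M.init.toMeasure := by
        rw [hmap]
        exact lintegral_map hf (MeasurableEquiv.measurable _)
    _ = pmfMean M.init f := lintegral_toMeasure _ _

theorem lintegral_trajLaw_succ [Countable Z] (M : MDP Z Act) (π : Policy Act) {n : ℕ}
    {Φ : (ℕ → Z) → ℝ≥0∞} (hΦ : DependsOn Φ (Finset.Iic n : Set ℕ)) (f : Z → ℝ≥0∞) :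
    ∫⁻ τ, Φ τ * f (τ (n + 1)) ∂(M.trajLaw π) =
      ∫⁻ τ, Φ τ * pmfMean (M.step π (τ n)) f ∂(M.trajLaw π) := by
  have : Nonempty Z := M.init.support_nonempty.to_type
  obtain ⟨φ, rfl⟩ := dependsOn_iff_exists_comp.1 hΦ
  have hφ : Measurable φ := .of_discrete
  have hf : Measurable f := .of_discrete
  have hlaw := Kernel.map_frestrictLe_trajMeasure_compProd_eq_map_trajMeasure
    (X := fun _ => Z) (μ₀ := M.init.toMeasure) (κ := M.stepKernel π) (a := n)
  have hint := congrArg (fun μ => ∫⁻ x, φ x.1 * f x.2 ∂μ) hlaw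
  rw [Measure.lintegral_compProd (by fun_prop), lintegral_map .of_discrete (by fun_prop),
    lintegral_map (by fun_prop) (by fun_prop)] at hint
  refine hint.symm.trans (lintegral_congr fun τ => ?_)
  refine (lintegral_const_mul (μ := (M.step π (τ n)).toMeasure)
    (φ (Preorder.frestrictLe (π := fun _ => Z) n τ)) hf).trans ?_
  rw [lintegral_toMeasure]
  rfl

theorem lintegral_trajLaw_mul_prod [Countable Z] (M : MDP Z Act) (π : Policy Act)
    (g f : Z → ℝ≥0∞) {i : ℕ} {Φ : (ℕ → Z) → ℝ≥0∞} (hΦ : DependsOn Φ (Finset.Iic i : Set ℕ))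
    (n : ℕ) :
    ∫⁻ τ, Φ τ * ((∏ t ∈ Finset.range n, g (τ (i + t))) * f (τ (i + n))) ∂(M.trajLaw π) =
      ∫⁻ τ, Φ τ * (transOp (M.step π) g ^ n) f (τ i) ∂(M.trajLaw π) := by
  induction n generalizing f with
  | zero => simp
  | succ n ih =>
    have hdep : DependsOn (fun τ => Φ τ * ∏ t ∈ Finset.range (n + 1), g (τ (i + t)))
        (Finset.Iic (i + n) : Set ℕ) := fun τ τ' h => by
      dsimp only
      rw [hΦ fun j hj => h j (by simp at hj ⊢; omega)]
      congr 1
      refine Finset.prod_congr rfl fun t ht => ?_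
      rw [h (i + t) (by simp at ht ⊢; omega)]
    calc ∫⁻ τ, Φ τ * ((∏ t ∈ Finset.range (n + 1), g (τ (i + t))) * f (τ (i + (n + 1))))
          ∂(M.trajLaw π)
        = ∫⁻ τ, (Φ τ * ∏ t ∈ Finset.range (n + 1), g (τ (i + t))) *
            pmfMean (M.step π (τ (i + n))) f ∂(M.trajLaw π) := by
          rw [← lintegral_trajLaw_succ M π hdep]
          simp only [mul_assoc, add_assoc]
      _ = ∫⁻ τ, Φ τ * ((∏ t ∈ Finset.range n, g (τ (i + t))) *
            transOp (M.step π) g f (τ (i + n))) ∂(M.trajLaw π) := by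
          simp only [Finset.prod_range_succ, transOp_apply, mul_assoc]
      _ = ∫⁻ τ, Φ τ * (transOp (M.step π) g ^ (n + 1)) f (τ i) ∂(M.trajLaw π) := by
          rw [ih, pow_succ, Module.End.mul_apply]

theorem lintegral_trajLaw_tsum_prod_mul [Countable Z] (M : MDP Z Act) (π : Policy Act)
    (g r : Z → ℝ≥0∞) :
    ∫⁻ τ, ∑' i, (∏ t ∈ Finset.range i, g (τ t)) * r (τ i) ∂(M.trajLaw π) =
      pmfMean M.init (totalReward (M.step π) g r) := by
  have hterm (i : ℕ) : ∫⁻ τ, (∏ t ∈ Finset.range i, g (τ t)) * r (τ i) ∂(M.trajLaw π) =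
      ∫⁻ τ, (transOp (M.step π) g ^ i) r (τ 0) ∂(M.trajLaw π) := by
    simpa only [one_mul, zero_add] using
      M.lintegral_trajLaw_mul_prod π g r (i := 0)
        ((dependsOn_const 1).mono (Set.empty_subset _)) i
  have hmeas (i : ℕ) :
      Measurable fun τ : ℕ → Z => (∏ t ∈ Finset.range i, g (τ t)) * r (τ i) :=
    (measurable_prod_comp_apply g (Finset.range i) id).mul (measurable_comp_apply r i)
  rw [← lintegral_trajLaw_zero M π, lintegral_tsum fun i => (hmeas i).aemeasurable]
  simp only [hterm, totalReward]
  exact (lintegral_tsum fun i => (measurable_comp_apply _ 0).aemeasurable).symm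

end MDP

section Visits

variable {Z : Type*} {G : Set Z} {c : ℝ≥0∞} {τ : ℕ → Z}

open Classical in
/-- The factor `γ_t` of the eventual discount, as a function of the state at time `t` and with an
extended nonnegative discount `c` in place of `γ`. -/
noncomputable def visitWeight (G : Set Z) (c : ℝ≥0∞) (z : Z) : ℝ≥0∞ := if z ∈ G then c else 1

theorem visitWeight_of_mem {z : Z} (hz : z ∈ G) : visitWeight G c z = c := if_pos hz

theorem visitWeight_of_notMem {z : Z} (hz : z ∉ G) : visitWeight G c z = 1 := if_neg hz

theorem visitWeight_le_one (hc : c ≤ 1) (z : Z) : visitWeight G c z ≤ 1 := by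
  unfold visitWeight
  split_ifs
  exacts [hc, le_rfl]

open Classical in
theorem prod_visitWeight (G : Set Z) (c : ℝ≥0∞) (τ : ℕ → Z) (n : ℕ) :
    ∏ t ∈ Finset.range n, visitWeight G c (τ t) = c ^ Nat.count (τ · ∈ G) n := by
  induction n with
  | zero => simp
  | succ n ih =>
    rw [Finset.prod_range_succ, ih, Nat.count_succ, pow_add, visitWeight]
    split_ifs <;> simp

theorem numVisits_eq_tsum (G : Set Z) (τ : ℕ → Z) :
    numVisits G τ = ∑' i, G.indicator 1 (τ i) := by
  rw [numVisits, ← ENNReal.tsum_set_one, tsum_subtype (visits G τ) fun _ => (1 : ℝ≥0∞)]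
  rfl

/-- The discounted number `∑ i, Γ_i 1{τ i ∈ G}` of visits to `G`, the integrand of `MDP.value`, for
an extended nonnegative discount `c`. -/
noncomputable def discountedVisits (G : Set Z) (c : ℝ≥0∞) (τ : ℕ → Z) : ℝ≥0∞ :=
  ∑' i, (∏ t ∈ Finset.range i, visitWeight G c (τ t)) * G.indicator 1 (τ i)

theorem discountedVisits_le_numVisits (hc : c ≤ 1) (τ : ℕ → Z) :
    discountedVisits G c τ ≤ numVisits G τ := by
  rw [numVisits_eq_tsum]
  exact ENNReal.tsum_le_tsum fun i =>
    mul_le_of_le_one_left' (Finset.prod_le_one' fun t _ => visitWeight_le_one hc _)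

theorem one_sub_mul_indicator_add_visitWeight (hc : c ≤ 1) (z : Z) :
    (1 - c) * G.indicator 1 z + visitWeight G c z = 1 := by
  by_cases hz : z ∈ G
  · simp [hz, visitWeight_of_mem, tsub_add_cancel_of_le hc]
  · simp [hz, visitWeight_of_notMem]

theorem one_sub_mul_sum_prod_mul_indicator_add_prod (hc : c ≤ 1) (τ : ℕ → Z) (n : ℕ) :
    (1 - c) * ∑ i ∈ Finset.range n,
        (∏ t ∈ Finset.range i, visitWeight G c (τ t)) * G.indicator 1 (τ i) +
      ∏ t ∈ Finset.range n, visitWeight G c (τ t) = 1 := by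
  induction n with
  | zero => simp
  | succ n ih =>
    rw [Finset.sum_range_succ, Finset.prod_range_succ]
    set P := ∏ t ∈ Finset.range n, visitWeight G c (τ t)
    calc _ = (1 - c) * ∑ i ∈ Finset.range n,
            (∏ t ∈ Finset.range i, visitWeight G c (τ t)) * G.indicator 1 (τ i) +
          P * ((1 - c) * G.indicator 1 (τ n) + visitWeight G c (τ n)) := by ring
      _ = 1 := by rw [one_sub_mul_indicator_add_visitWeight hc, mul_one, ih]

theorem one_sub_mul_discountedVisits_le_one (hc : c ≤ 1) (τ : ℕ → Z) :
    (1 - c) * discountedVisits G c τ ≤ 1 := by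
  rw [discountedVisits, ← ENNReal.tsum_mul_left]
  refine ENNReal.tsum_le_of_sum_range_le fun n => ?_
  rw [← Finset.mul_sum]
  exact le_self_add.trans_eq (one_sub_mul_sum_prod_mul_indicator_add_prod hc τ n)

theorem one_le_one_sub_mul_discountedVisits (hc : c < 1) (hτ : τ ∈ satSet G) :
    1 ≤ (1 - c) * discountedVisits G c τ := by
  classical
  have hinf : {t | τ t ∈ G}.Infinite := Nat.frequently_atTop_iff_infinite.1 hτ
  have hlim : Tendsto (fun k : ℕ => (1 - c) * discountedVisits G c τ + c ^ k) atTop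
      (nhds ((1 - c) * discountedVisits G c τ + 0)) :=
    tendsto_const_nhds.add (ENNReal.tendsto_pow_atTop_nhds_zero_of_lt_one hc)
  rw [add_zero] at hlim
  refine ge_of_tendsto' hlim fun k => ?_
  have hprod : ∏ t ∈ Finset.range (Nat.nth (τ · ∈ G) k), visitWeight G c (τ t) = c ^ k := by
    rw [prod_visitWeight, Nat.count_nth_of_infinite hinf]
  calc 1 = (1 - c) * ∑ i ∈ Finset.range (Nat.nth (τ · ∈ G) k),
          (∏ t ∈ Finset.range i, visitWeight G c (τ t)) * G.indicator 1 (τ i) + c ^ k := by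
        rw [← hprod]
        exact (one_sub_mul_sum_prod_mul_indicator_add_prod hc.le τ _).symm
    _ ≤ (1 - c) * discountedVisits G c τ + c ^ k := by
        gcongr
        exact ENNReal.sum_le_tsum _

/-- Counted backwards from time `n`, the `k`-th last visit has weight `c ^ k`. -/
theorem one_sub_mul_sum_indicator_mul_prod_Ico_le (hc : c ≤ 1) (τ : ℕ → Z) (n : ℕ) :
    (1 - c) * ∑ i ∈ Finset.range n,
      G.indicator 1 (τ i) * ∏ t ∈ Finset.Ico i n, visitWeight G c (τ t) ≤ c := by
  induction n with
  | zero => simp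
  | succ n ih =>
    set S := ∑ i ∈ Finset.range n,
      G.indicator 1 (τ i) * ∏ t ∈ Finset.Ico i n, visitWeight G c (τ t) with hS
    have hsucc : ∑ i ∈ Finset.range (n + 1),
        G.indicator 1 (τ i) * ∏ t ∈ Finset.Ico i (n + 1), visitWeight G c (τ t) =
          (S + G.indicator 1 (τ n)) * visitWeight G c (τ n) := by
      rw [Finset.sum_range_succ, add_mul, hS, Finset.sum_mul, Nat.Ico_succ_singleton,
        Finset.prod_singleton]
      congr 1
      refine Finset.sum_congr rfl fun i hi => ?_
      rw [Finset.prod_Ico_succ_top (Finset.mem_range.1 hi).le, mul_assoc]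
    rw [hsucc]
    by_cases hz : τ n ∈ G
    · rw [visitWeight_of_mem hz, Set.indicator_of_mem hz, ← mul_assoc, mul_add]
      refine mul_le_of_le_one_left' ?_
      calc (1 - c) * S + (1 - c) * 1 ≤ c + (1 - c) := by rw [mul_one]; gcongr
        _ = 1 := add_tsub_cancel_of_le hc
    · rwa [visitWeight_of_notMem hz, Set.indicator_of_notMem hz, add_zero, mul_one]

/-- The infinite product `∏ t ≥ i, g (τ t)` of the weights along `τ` from time `i` on, expressed as
the infimum of the partial products; it is meant for weights `g ≤ 1`. -/
noncomputable def tailWeight (g : Z → ℝ≥0∞) (τ : ℕ → Z) (i : ℕ) : ℝ≥0∞ :=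
  ⨅ n, ∏ t ∈ Finset.range n, g (τ (i + t))

theorem one_sub_mul_tsum_indicator_mul_tailWeight_le (hc : c ≤ 1) (τ : ℕ → Z) :
    (1 - c) * ∑' i, G.indicator 1 (τ i) * tailWeight (visitWeight G c) τ i ≤ c := by
  rw [← ENNReal.tsum_mul_left]
  refine ENNReal.tsum_le_of_sum_range_le fun n => ?_
  rw [← Finset.mul_sum]
  refine le_trans ?_ (one_sub_mul_sum_indicator_mul_prod_Ico_le (G := G) hc τ n)
  gcongr with i
  rw [Finset.prod_Ico_eq_prod_range]
  exact iInf_le _ (n - i)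

theorem tailWeight_visitWeight_ne_zero (hc : c ≤ 1) (hc₀ : c ≠ 0) (hτ : τ ∉ satSet G) (i : ℕ) :
    tailWeight (visitWeight G c) τ i ≠ 0 := by
  classical
  have hvisits : {t | τ t ∈ G}.Finite := by
    simpa [satSet, Nat.frequently_atTop_iff_infinite] using hτ
  have hfin : {t | τ (i + t) ∈ G}.Finite :=
    Set.Finite.preimage (s := {t | τ t ∈ G}) (add_right_injective i).injOn hvisits
  have hle (n : ℕ) : c ^ hfin.toFinset.card ≤
      ∏ t ∈ Finset.range n, visitWeight G c (τ (i + t)) := by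
    rw [prod_visitWeight G c fun t => τ (i + t)]
    exact pow_le_pow_right_of_le_one' hc (Nat.count_le_card hfin n)
  exact ((ENNReal.pow_pos hc₀.bot_lt _).trans_le (le_iInf hle)).ne'

theorem measurableSet_satSet [MeasurableSpace Z] [DiscreteMeasurableSpace Z] (G : Set Z) :
    MeasurableSet (satSet G) := by
  have hlimsup : satSet G = limsup (fun i => {τ : ℕ → Z | τ i ∈ G}) atTop := by
    ext τ
    simp [satSet, mem_limsup_iff_frequently_mem]
  rw [hlimsup]
  exact .measurableSet_limsup fun i => measurable_pi_apply i (.of_discrete (s := G))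

end Visits

theorem exists_ne_zero_forall_le_of_ne_zero {ι : Type*} [Finite ι] (w : ι → ℝ≥0∞) :
    ∃ ε ≠ 0, ∀ i, w i ≠ 0 → ε ≤ w i := by
  have : (nhdsWithin (0 : ℝ≥0∞) (Set.Ioi 0)).NeBot := nhdsGT_neBot_of_exists_gt ⟨1, one_pos⟩
  have hsmall : ∀ᶠ ε in nhdsWithin (0 : ℝ≥0∞) (Set.Ioi 0), ∀ i, w i ≠ 0 → ε ≤ w i :=
    eventually_all.2 fun i => by
      by_cases hi : w i = 0
      · simp [hi]
      · exact ((eventually_le_nhds (pos_iff_ne_zero.2 hi)).filter_mono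
          nhdsWithin_le_nhds).mono fun _ h _ => h
  obtain ⟨ε, hε, hpos⟩ := (hsmall.and self_mem_nhdsWithin).exists
  exact ⟨ε, ne_of_gt hpos, hε⟩

theorem lintegral_mul_iInf {α : Type*} [MeasurableSpace α] {μ : Measure α} {φ : α → ℝ≥0∞}
    (hφ : Measurable φ) (hφ_top : ∀ x, φ x ≠ ∞) {f : ℕ → α → ℝ≥0∞} (hf : ∀ n, Measurable (f n))
    (hanti : Antitone f) (hfin : ∫⁻ x, φ x * f 0 x ∂μ ≠ ∞) :
    ∫⁻ x, φ x * ⨅ n, f n x ∂μ = ⨅ n, ∫⁻ x, φ x * f n x ∂μ := by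
  simp only [ENNReal.mul_iInf fun h => absurd h (hφ_top _)]
  exact lintegral_iInf (fun n => hφ.mul (hf n))
    (fun m n hmn x => mul_le_mul_right (hanti hmn x) _) hfin

theorem measurable_tailWeight {Z : Type*} [MeasurableSpace Z] [DiscreteMeasurableSpace Z]
    (g : Z → ℝ≥0∞) (i : ℕ) : Measurable fun τ => tailWeight g τ i :=
  .iInf fun n => measurable_prod_comp_apply g (Finset.range n) (i + ·)

theorem transOp_pow_one_antitone {Z : Type*} (p : Z → PMF Z) {g : Z → ℝ≥0∞}
    (hg : ∀ z, g z ≤ 1) : Antitone fun n => (transOp p g ^ n) 1 := by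
  refine antitone_nat_of_succ_le fun n => ?_
  rw [pow_succ, Module.End.mul_apply]
  refine transOp_pow_mono p g n fun z => ?_
  exact mul_le_one' (hg z) (pmfMean_const (p z) 1).le

/-- The expectation of `tailWeight g` along the Markov chain with transition function `p` started
at `z`, for weights `g ≤ 1`. -/
noncomputable def meanTailWeight {Z : Type*} (p : Z → PMF Z) (g : Z → ℝ≥0∞) (z : Z) : ℝ≥0∞ :=
  ⨅ n, (transOp p g ^ n) 1 z

namespace MDP

variable {Z : Type*} {Act : Z → Type*} [MeasurableSpace Z] [DiscreteMeasurableSpace Z]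

theorem lintegral_indicator_mul_tailWeight [Countable Z] (M : MDP Z Act) (π : Policy Act)
    {g : Z → ℝ≥0∞} (hg : ∀ z, g z ≤ 1) (U : Set Z) (i : ℕ) :
    ∫⁻ τ, U.indicator 1 (τ i) * tailWeight g τ i ∂(M.trajLaw π) =
      ∫⁻ τ, U.indicator 1 (τ i) * meanTailWeight (M.step π) g (τ i) ∂(M.trajLaw π) := by
  have hU : Measurable fun τ : ℕ → Z => U.indicator (1 : Z → ℝ≥0∞) (τ i) :=
    measurable_comp_apply _ i
  have hU₁ (z : Z) : U.indicator (1 : Z → ℝ≥0∞) z ≤ 1 :=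
    Set.indicator_le_self' (fun _ _ => zero_le) z
  have hU_top (τ : ℕ → Z) : U.indicator (1 : Z → ℝ≥0∞) (τ i) ≠ ∞ :=
    ne_top_of_le_ne_top ENNReal.one_ne_top (hU₁ _)
  have hfin : ∫⁻ τ, U.indicator 1 (τ i) ∂(M.trajLaw π) ≠ ∞ :=
    ne_top_of_le_ne_top (measure_ne_top (M.trajLaw π) Set.univ)
      ((lintegral_mono fun τ : ℕ → Z => hU₁ (τ i)).trans_eq lintegral_one)
  have hdep : DependsOn (fun τ : ℕ → Z => U.indicator (1 : Z → ℝ≥0∞) (τ i))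
      (Finset.Iic i : Set ℕ) := fun _ _ h => congrArg (U.indicator 1) (h i (by simp))
  simp only [tailWeight, meanTailWeight]
  rw [lintegral_mul_iInf hU hU_top
      (fun n => measurable_prod_comp_apply g (Finset.range n) (i + ·))
      (fun m n hmn _ => Finset.prod_le_prod_of_subset_of_le_one' (Finset.range_mono hmn)
        fun t _ _ => hg _) (by simpa using hfin),
    lintegral_mul_iInf hU hU_top (fun n => measurable_comp_apply _ i)
      (fun m n hmn τ => transOp_pow_one_antitone (M.step π) hg hmn (τ i)) (by simpa using hfin)]
  refine iInf_congr fun n => ?_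
  simpa only [Pi.one_apply, mul_one] using M.lintegral_trajLaw_mul_prod π g 1 hdep n

theorem ae_meanTailWeight_ne_zero_of_notMem_satSet [Countable Z] (M : MDP Z Act) (G : Set Z)
    (π : Policy Act) {c : ℝ≥0∞} (hc : c ≤ 1) (hc₀ : c ≠ 0) (i : ℕ) :
    ∀ᵐ τ ∂(M.trajLaw π), τ ∉ satSet G →
      meanTailWeight (M.step π) (visitWeight G c) (τ i) ≠ 0 := by
  set w := meanTailWeight (M.step π) (visitWeight G c)
  have hint : ∫⁻ τ, {z | w z = 0}.indicator 1 (τ i) * tailWeight (visitWeight G c) τ i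
      ∂(M.trajLaw π) = 0 := by
    rw [M.lintegral_indicator_mul_tailWeight π (visitWeight_le_one hc) {z | w z = 0} i]
    refine (lintegral_congr fun τ => ?_).trans lintegral_zero
    by_cases hτ : w (τ i) = 0
    · exact mul_eq_zero_of_right _ hτ
    · exact mul_eq_zero_of_left (Set.indicator_of_notMem hτ 1) _
  have hmeas : Measurable fun τ =>
      {z | w z = 0}.indicator (1 : Z → ℝ≥0∞) (τ i) * tailWeight (visitWeight G c) τ i :=
    (measurable_comp_apply _ i).mul (measurable_tailWeight _ i)
  rw [lintegral_eq_zero_iff hmeas] at hint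
  filter_upwards [hint] with τ hτ hsat hw
  rw [Pi.zero_apply, Set.indicator_of_mem (s := {z | w z = 0}) hw, Pi.one_apply, one_mul] at hτ
  exact tailWeight_visitWeight_ne_zero hc hc₀ hsat i hτ

theorem one_sub_mul_tsum_lintegral_indicator_mul_meanTailWeight_le [Countable Z] (M : MDP Z Act)
    (G : Set Z) (π : Policy Act) {c : ℝ≥0∞} (hc : c ≤ 1) :
    (1 - c) * ∑' i, ∫⁻ τ, G.indicator 1 (τ i) *
      meanTailWeight (M.step π) (visitWeight G c) (τ i) ∂(M.trajLaw π) ≤ c := by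
  simp only [← M.lintegral_indicator_mul_tailWeight π (visitWeight_le_one hc) G]
  have hmeas (i : ℕ) : Measurable fun τ =>
      G.indicator (1 : Z → ℝ≥0∞) (τ i) * tailWeight (visitWeight G c) τ i :=
    (measurable_comp_apply _ i).mul (measurable_tailWeight _ i)
  rw [← lintegral_tsum fun i => (hmeas i).aemeasurable,
    ← lintegral_const_mul' _ _ (by finiteness)]
  calc ∫⁻ τ, (1 - c) * ∑' i, G.indicator 1 (τ i) * tailWeight (visitWeight G c) τ i
        ∂(M.trajLaw π)
      ≤ ∫⁻ _, c ∂(M.trajLaw π) :=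
        lintegral_mono fun τ => one_sub_mul_tsum_indicator_mul_tailWeight_le hc τ
    _ = c := by rw [lintegral_const, measure_univ, mul_one]

/-- Off `satSet G` the chain almost surely stays among the states with positive mean tail weight;
on a finite state space these weights are bounded below by some `ε`, so `ε` times the number of
visits is dominated by the sum of the mean tail weights at the visits. -/
theorem setLIntegral_numVisits_ne_top [Finite Z] (M : MDP Z Act) (G : Set Z) (π : Policy Act) :
    ∫⁻ τ in (satSet G)ᶜ, numVisits G τ ∂(M.trajLaw π) ≠ ∞ := by
  set w := meanTailWeight (M.step π) (visitWeight G 2⁻¹)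
  have hhalf : (2⁻¹ : ℝ≥0∞) ≤ 1 := by simp
  obtain ⟨ε, hε, hεw⟩ := exists_ne_zero_forall_le_of_ne_zero w
  have hmeas (i : ℕ) : Measurable fun τ : ℕ → Z => G.indicator (1 : Z → ℝ≥0∞) (τ i) :=
    measurable_comp_apply _ i
  have hvisit (i : ℕ) : ε * ∫⁻ τ in (satSet G)ᶜ, G.indicator 1 (τ i) ∂(M.trajLaw π) ≤
      ∫⁻ τ, G.indicator 1 (τ i) * w (τ i) ∂(M.trajLaw π) := by
    rw [← lintegral_const_mul ε (hmeas i)]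
    refine (lintegral_mono_ae ?_).trans (setLIntegral_le_lintegral (satSet G)ᶜ _)
    rw [ae_restrict_iff' (measurableSet_satSet G).compl]
    filter_upwards [M.ae_meanTailWeight_ne_zero_of_notMem_satSet G π hhalf (by simp) i]
      with τ hw hτ
    rw [mul_comm]
    gcongr
    exact hεw _ (hw hτ)
  have hbound : (1 - 2⁻¹) * (ε * ∫⁻ τ in (satSet G)ᶜ, numVisits G τ ∂(M.trajLaw π)) ≤ 2⁻¹ := by
    simp only [numVisits_eq_tsum]
    rw [lintegral_tsum fun i => (hmeas i).aemeasurable, ← ENNReal.tsum_mul_left]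
    exact (mul_le_mul_right (ENNReal.tsum_le_tsum hvisit) _).trans
      (M.one_sub_mul_tsum_lintegral_indicator_mul_meanTailWeight_le G π hhalf)
  intro htop
  rw [htop, ENNReal.mul_top hε, ENNReal.mul_top (by simp)] at hbound
  simp at hbound

end MDP

namespace MDP

variable {Z : Type*} {Act : Z → Type*} [MeasurableSpace Z] [DiscreteMeasurableSpace Z] {G : Set Z}
  {γ : ℝ} {π π' : Policy Act}

theorem value_eq_lintegral_discountedVisits (M : MDP Z Act) (G : Set Z) (π : Policy Act)
    (hγ : 0 ≤ γ) :
    M.value G γ π = ∫⁻ τ, discountedVisits G (ENNReal.ofReal γ) τ ∂(M.trajLaw π) := by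
  classical
  have hweight (z : Z) : 0 ≤ if z ∈ G then γ else 1 := by positivity
  refine lintegral_congr fun τ => tsum_congr fun i => ?_
  rw [eventualDiscount, ENNReal.ofReal_mul (Finset.prod_nonneg fun t _ => hweight _),
    ENNReal.ofReal_prod_of_nonneg fun t _ => hweight _]
  simp only [visitWeight, Set.indicator_apply, apply_ite ENNReal.ofReal, ENNReal.ofReal_one,
    ENNReal.ofReal_zero, Pi.one_apply]

theorem value_eq_pmfMean_totalReward [Countable Z] (M : MDP Z Act) (G : Set Z) (π : Policy Act)
    (hγ : 0 ≤ γ) :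
    M.value G γ π = pmfMean M.init
      (totalReward (M.step π) (visitWeight G (ENNReal.ofReal γ)) (G.indicator 1)) := by
  rw [M.value_eq_lintegral_discountedVisits G π hγ]
  exact M.lintegral_trajLaw_tsum_prod_mul π _ _

theorem exists_detPolicy_value [Finite Z] [∀ z, Finite (Act z)] [∀ z, Nonempty (Act z)]
    (M : MDP Z Act) (G : Set Z) (hγ : γ ∈ Set.Icc (0 : ℝ) 1) :
    ∃ d : DetPolicy Act, ∀ π : Policy Act, M.value G γ π ≤ M.value G γ d.toPolicy := by
  obtain ⟨d, hd⟩ := M.exists_detPolicy_totalReward (r := G.indicator 1)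
    (visitWeight_le_one (G := G) (ENNReal.ofReal_le_one.2 hγ.2))
    (fun z => Set.indicator_le_self' (fun _ _ => zero_le) z) ENNReal.one_ne_top
  refine ⟨d, fun π => ?_⟩
  rw [M.value_eq_pmfMean_totalReward G π hγ.1, M.value_eq_pmfMean_totalReward G _ hγ.1]
  exact pmfMean_mono M.init (hd π)

theorem measure_satSet_le_value (M : MDP Z Act) (G : Set Z) (π : Policy Act)
    (hγ : γ ∈ Set.Ico (0 : ℝ) 1) :
    M.trajLaw π (satSet G) ≤ ENNReal.ofReal (1 - γ) * M.value G γ π := by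
  rw [M.value_eq_lintegral_discountedVisits G π hγ.1, ENNReal.ofReal_sub 1 hγ.1,
    ENNReal.ofReal_one, ← lintegral_const_mul' _ _ (by finiteness),
    ← lintegral_indicator_one (measurableSet_satSet G)]
  exact lintegral_mono fun τ => Set.indicator_le
    (fun τ => one_le_one_sub_mul_discountedVisits (ENNReal.ofReal_lt_one.2 hγ.2)) τ

theorem value_le_measure_satSet_add (M : MDP Z Act) (G : Set Z) (π : Policy Act)
    (hγ : γ ∈ Set.Icc (0 : ℝ) 1) :
    ENNReal.ofReal (1 - γ) * M.value G γ π ≤ M.trajLaw π (satSet G) +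
      ENNReal.ofReal (1 - γ) * ∫⁻ τ in (satSet G)ᶜ, numVisits G τ ∂(M.trajLaw π) := by
  have hc : ENNReal.ofReal γ ≤ 1 := ENNReal.ofReal_le_one.2 hγ.2
  rw [M.value_eq_lintegral_discountedVisits G π hγ.1, ENNReal.ofReal_sub 1 hγ.1,
    ENNReal.ofReal_one, ← lintegral_const_mul' _ _ (by finiteness),
    ← lintegral_const_mul' _ _ (by finiteness),
    ← lintegral_add_compl _ (measurableSet_satSet G), ← setLIntegral_one (satSet G)]
  gcongr with τ τ
  · exact one_sub_mul_discountedVisits_le_one hc τ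
  · exact discountedVisits_le_numVisits hc τ

theorem measure_satSet_le_add_of_value_le (M : MDP Z Act) (hγ : γ ∈ Set.Ico (0 : ℝ) 1)
    (h : M.value G γ π ≤ M.value G γ π') :
    M.trajLaw π (satSet G) ≤ M.trajLaw π' (satSet G) +
      ENNReal.ofReal (1 - γ) * ∫⁻ τ in (satSet G)ᶜ, numVisits G τ ∂(M.trajLaw π') :=
  calc M.trajLaw π (satSet G)
      ≤ ENNReal.ofReal (1 - γ) * M.value G γ π := M.measure_satSet_le_value G π hγ
    _ ≤ ENNReal.ofReal (1 - γ) * M.value G γ π' := by gcongr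
    _ ≤ _ := M.value_le_measure_satSet_add G π' (Set.Ico_subset_Icc_self hγ)

/-- One of the finitely many deterministic policies maximizes the value for `γ` arbitrarily close
to `1`; let `γ → 1` along these. -/
theorem exists_detPolicy_satProb [Finite Z] [∀ z, Finite (Act z)] [∀ z, Nonempty (Act z)]
    (M : MDP Z Act) (G : Set Z) :
    ∃ d : DetPolicy Act, ∀ π : Policy Act, M.satProb G π ≤ M.satProb G d.toPolicy := by
  have hγ : ∀ᶠ γ : ℝ in nhdsWithin 1 (Set.Iio 1), γ ∈ Set.Ico (0 : ℝ) 1 :=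
    Ico_mem_nhdsLT one_pos
  obtain ⟨d, hd⟩ := frequently_exists.1
    (hγ.mono fun γ h => M.exists_detPolicy_value G (Set.Ico_subset_Icc_self h)).frequently
  refine ⟨d, fun π => ENNReal.toReal_mono (measure_ne_top _ _) ?_⟩
  set K := ∫⁻ τ in (satSet G)ᶜ, numVisits G τ ∂(M.trajLaw d.toPolicy)
  have hsub : Tendsto (fun γ : ℝ => ENNReal.ofReal (1 - γ)) (nhdsWithin 1 (Set.Iio 1)) (nhds 0) :=
    tendsto_nhdsWithin_of_tendsto_nhds <|
      (ENNReal.continuous_ofReal.comp (continuous_const.sub continuous_id)).tendsto' 1 0 (by simp)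
  have hlim : Tendsto (fun γ : ℝ => M.trajLaw d.toPolicy (satSet G) + ENNReal.ofReal (1 - γ) * K)
      (nhdsWithin 1 (Set.Iio 1)) (nhds (M.trajLaw d.toPolicy (satSet G) + 0 * K)) :=
    tendsto_const_nhds.add
      (ENNReal.Tendsto.mul_const hsub (Or.inr (M.setLIntegral_numVisits_ne_top G d.toPolicy)))
  rw [zero_mul, add_zero] at hlim
  exact ge_of_tendsto_of_frequently hlim ((hd.and_eventually hγ).mono
    fun γ h => M.measure_satSet_le_add_of_value_le h.2 (h.1 π))

theorem setLIntegral_numVisits_le_expVisits (M : MDP Z Act) (G : Set Z) (π : Policy Act) :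
    ∫⁻ τ in (satSet G)ᶜ, numVisits G τ ∂(M.trajLaw π) ≤ M.expVisits G π := by
  rw [expVisits, ProbabilityTheory.cond, lintegral_smul_measure, smul_eq_mul]
  exact le_mul_of_one_le_left' (ENNReal.one_le_inv.2 prob_le_one)

theorem expVisits_ne_top [Finite Z] (M : MDP Z Act) (G : Set Z) (π : Policy Act) :
    M.expVisits G π ≠ ∞ := by
  rw [expVisits, ProbabilityTheory.cond]
  by_cases h : M.trajLaw π (satSet G)ᶜ = 0
  · simp [Measure.restrict_eq_zero.2 h]
  · rw [lintegral_smul_measure, smul_eq_mul]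
    exact ENNReal.mul_ne_top (ENNReal.inv_ne_top.2 h) (M.setLIntegral_numVisits_ne_top G π)

theorem satProb_sub_le_of_value_le (M : MDP Z Act) (hγ : γ ∈ Set.Ico (0 : ℝ) 1)
    (h : M.value G γ π ≤ M.value G γ π') {m : ℝ≥0} (hm : M.expVisits G π' ≤ m) :
    M.satProb G π - M.satProb G π' ≤ (1 - γ) * m := by
  have hγ₁ : 0 ≤ 1 - γ := sub_nonneg.2 hγ.2.le
  have hle : M.trajLaw π (satSet G) ≤
      M.trajLaw π' (satSet G) + ENNReal.ofReal ((1 - γ) * m) := by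
    rw [ENNReal.ofReal_mul hγ₁, ENNReal.ofReal_coe_nnreal]
    refine (M.measure_satSet_le_add_of_value_le hγ h).trans ?_
    gcongr
    exact (M.setLIntegral_numVisits_le_expVisits G π').trans hm
  rw [sub_le_iff_le_add', satProb, satProb, Measure.real, Measure.real,
    ← ENNReal.toReal_ofReal (mul_nonneg hγ₁ m.coe_nonneg),
    ← ENNReal.toReal_add (measure_ne_top _ _) ENNReal.ofReal_ne_top]
  exact ENNReal.toReal_mono (by finiteness) hle

end MDP

theorem one_sub_mul_le_two_mul_log {γ m : ℝ} (hγ : γ ∈ Set.Ioc (0 : ℝ) 1) (hm : 0 ≤ m) :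
    (1 - γ) * m ≤ 2 * m * Real.log (1 / γ) := by
  have hlog : 1 - γ ≤ Real.log (1 / γ) := by
    simpa using Real.one_sub_inv_le_log_of_pos (inv_pos.2 hγ.1)
  have hgap : 0 ≤ m * (1 - γ) := mul_nonneg hm (sub_nonneg.2 hγ.2)
  linarith [mul_le_mul_of_nonneg_left hlog hm]

theorem mainTheorem3_general {Z : Type*} {Act : Z → Type*} [Finite Z] [MeasurableSpace Z]
    [DiscreteMeasurableSpace Z] [∀ z, Finite (Act z)] [∀ z, Nonempty (Act z)]
    (M : MDP Z Act) (G : Set Z) :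
    (∃ d : DetPolicy Act, ∀ π : Policy Act, M.satProb G π ≤ M.satProb G d.toPolicy) ∧
    (∀ γ ∈ Set.Icc (0 : ℝ) 1, ∃ d : DetPolicy Act, ∀ π : Policy Act,
      M.value G γ π ≤ M.value G γ d.toPolicy) ∧
    ∃ m : ℝ≥0,
      IsGreatest (Set.range fun d : DetPolicy Act => M.expVisits G d.toPolicy) (m : ℝ≥0∞) ∧
      ∀ γ ∈ Set.Ico (0 : ℝ) 1, ∀ dγ : DetPolicy Act,
        (∀ d : DetPolicy Act, M.value G γ d.toPolicy ≤ M.value G γ dγ.toPolicy) →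
        (⨆ π : Policy Act, M.satProb G π) - M.satProb G dγ.toPolicy ≤ (1 - γ) * m := by
  obtain ⟨d₀, hd₀⟩ := M.exists_detPolicy_satProb G
  have : Nonempty (DetPolicy Act) := ⟨d₀⟩
  have : Nonempty (Policy Act) := ⟨d₀.toPolicy⟩
  obtain ⟨d₁, hd₁⟩ := Finite.exists_max fun d : DetPolicy Act => M.expVisits G d.toPolicy
  lift M.expVisits G d₁.toPolicy to ℝ≥0 using M.expVisits_ne_top G d₁.toPolicy with m hm
  refine ⟨⟨d₀, hd₀⟩, fun γ hγ => M.exists_detPolicy_value G hγ,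
    m, ⟨⟨d₁, hm.symm⟩, Set.forall_mem_range.2 hd₁⟩, fun γ hγ dγ hdγ => ?_⟩
  exact (sub_le_sub_right (ciSup_le hd₀) _).trans
    (M.satProb_sub_le_of_value_le hγ (hdγ d₀) (hd₁ dγ))

theorem mainTheorem3 {S A AP Q : Type*} {J : Q → Type*}
    [Finite S] [MeasurableSpace S] [MeasurableSingletonClass S]
    [Finite A] [Nonempty A]
    [Finite Q] [MeasurableSpace Q] [MeasurableSingletonClass Q]
    [∀ b, Finite (J b)]
    (M : LabelledMDP S A AP) (B : LDBA AP Q J) :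
    -- the product has finitely many states, actions and deterministic policies
    Finite (S × Q) ∧ Finite (A ⊕ (Σ b, J b)) ∧ Finite (DetPolicy (ProductAct S A J)) ∧
    -- some deterministic policy maximizes the satisfaction probability among all policies
    (∃ d : DetPolicy (ProductAct S A J), ∀ π : Policy (ProductAct S A J),
      (productMDP M B).satProb (goodStates S B) π ≤
        (productMDP M B).satProb (goodStates S B) d.toPolicy) ∧
    -- some deterministic policy maximizes the eventually discounted value among all policies
    (∀ γ ∈ Set.Ioo (0 : ℝ) 1,
      ∃ d : DetPolicy (ProductAct S A J), ∀ π : Policy (ProductAct S A J),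
        (productMDP M B).value (goodStates S B) γ π ≤
          (productMDP M B).value (goodStates S B) γ d.toPolicy) ∧
    -- the supremum of `O_π` over deterministic policies is finite and attained, and bounds the gap
    ∃ m : ℝ≥0,
      IsGreatest (Set.range fun d : DetPolicy (ProductAct S A J) =>
        (productMDP M B).expVisits (goodStates S B) d.toPolicy) (m : ℝ≥0∞) ∧
      ∀ γ ∈ Set.Ioo (0 : ℝ) 1, ∀ dγ : DetPolicy (ProductAct S A J),
        (∀ d : DetPolicy (ProductAct S A J),
          (productMDP M B).value (goodStates S B) γ d.toPolicy ≤
            (productMDP M B).value (goodStates S B) γ dγ.toPolicy) →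
        (⨆ π : Policy (ProductAct S A J), (productMDP M B).satProb (goodStates S B) π) -
            (productMDP M B).satProb (goodStates S B) dγ.toPolicy ≤
          2 * m * Real.log (1 / γ) := by
  have (z : S × Q) : Finite (ProductAct S A J z) := inferInstance
  have (z : S × Q) : Nonempty (ProductAct S A J z) := inferInstance
  obtain ⟨hsat, hval, m, hm, hgap⟩ := mainTheorem3_general (productMDP M B) (goodStates S B)
  exact ⟨inferInstance, inferInstance, inferInstance, hsat,
    fun γ hγ => hval γ (Set.Ioo_subset_Icc_self hγ), m, hm, fun γ hγ dγ hdγ =>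
      (hgap γ (Set.Ioo_subset_Ico_self hγ) dγ hdγ).trans
        (one_sub_mul_le_two_mul_log (Set.Ioo_subset_Ioc_self hγ) m.2)⟩
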